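/- All graphs are finite, simple and have at least one vertex. For a connected graph $G$ with vertex set $V$, let $\mu(G)$ (the Colin de Verdière parameter) be the maximum corank (dimension of the kernel) of a real symmetric matrix $M$, with rows and columns indexed by $V$, such that 1. for all $i \neq j$, $M_{ij} < 0$ if $ij \in E(G)$ and $M_{ij} = 0$ if $ij \notin E(G)$ (the diagonal entries are arbitrary); 2. $M$ has exactly one negative eigenvalue, counted with multiplicity; 3. if $X$ is a real symmetric matrix indexed by $V$ with $MX = 0$, and $X_{ij} = 0$ whenever $i = j$ or $ij \in E(G)$, then $X = 0$. For a disconnected graph $G$, let $\mu(G)$ be the maximum of $\mu(H)$ over the connected components $H$ of $G$. Let $\overline{G}$ denote the complement of $G$. **Observation.** Suppose that every graph $G$ satisfies $\mu(G) + \mu(\overline{G}) \geq |V(G)| - 2$ (the graph complement conjecture for the Colin de Verdière parameter). Then every graph $G$ satisfies $$|E(G)| \leq (\mu(G)+1)\,|V(G)| - \binom{\mu(G)+2}{2}.$$ -/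

import Mathlib

universe u

namespace ColinDeVerdiere

/-- The matrices admitted in the definition of the Colin de Verdière parameter of a (connected)
graph `G`. Over `ℝ`, Hermitian means symmetric. -/
structure IsAdmissible {V : Type*} [Fintype V] (G : SimpleGraph V) (M : Matrix V V ℝ) : Prop where
  isHermitian : M.IsHermitian
  apply_eq_zero : ∀ i j, i ≠ j → ¬ G.Adj i j → M i j = 0
  apply_neg : ∀ i j, G.Adj i j → M i j < 0
  /-- Exactly one negative eigenvalue: `eigenvalues` is the family, indexed by `V`, of the
  eigenvalues repeated according to multiplicity. -/
  existsUnique_neg_eigenvalue :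
    letI := Classical.decEq V
    ∃! i, isHermitian.eigenvalues i < 0
  /-- The strong Arnold property. -/
  strongArnold : ∀ X : Matrix V V ℝ, X.IsSymm → M * X = 0 →
    (∀ i j, i = j ∨ G.Adj i j → X i j = 0) → X = 0

/-- The corank of a square matrix: the dimension of its kernel. -/
noncomputable def corank {V : Type*} [Fintype V] (M : Matrix V V ℝ) : ℕ :=
  Module.finrank ℝ (LinearMap.ker M.mulVecLin)

/-- The set of coranks of admissible matrices. -/
def coranks {V : Type*} [Fintype V] (G : SimpleGraph V) : Set ℕ :=
  {k | ∃ M : Matrix V V ℝ, IsAdmissible G M ∧ corank M = k}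

theorem corank_le_card {V : Type*} [Fintype V] (M : Matrix V V ℝ) :
    corank M ≤ Fintype.card V := by
  simpa [corank] using Submodule.finrank_le (LinearMap.ker M.mulVecLin)

/-- The supremum below is that of a bounded set. -/
theorem bddAbove_coranks {V : Type*} [Fintype V] (G : SimpleGraph V) : BddAbove (coranks G) :=
  ⟨Fintype.card V, by rintro _ ⟨M, _, rfl⟩; exact corank_le_card M⟩

/-- The Colin de Verdière parameter of a connected graph: the maximum corank of an admissible
matrix. -/
noncomputable def muConnected {V : Type*} [Fintype V] (G : SimpleGraph V) : ℕ :=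
  sSup (coranks G)

open Classical in
/-- The Colin de Verdière parameter `μ(G)` of a finite graph: the maximum of the parameters of
its connected components. -/
noncomputable def mu {V : Type*} [Fintype V] (G : SimpleGraph V) : ℕ :=
  ⨆ C : G.ConnectedComponent, muConnected C.toSimpleGraph

end ColinDeVerdiere

namespace ColinDeVerdiere

open Matrix

/-! Put n = |V| and t = n - 1 - μ(G). Passing to the complement, the claim becomes |E(Gᶜ)| ≥ C(t,
2), while the conjecture gives μ(Gᶜ) ≥ t - 1. It would suffice that |E(H)| ≥ C(μ(H) + 1, 2) for
every H.

For connected H and admissible M of corank k, the symmetric X with MX = 0 contain a space of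
dimension C(k + 1, 2). By the strong Arnold property they are determined by their entries on the
diagonal and the edges, and these satisfy the relations (MX)ᵢᵢ = 0. If the relations are
independent, they cancel the diagonal and C(k + 1, 2) ≤ |E(H)|. Otherwise there is one dependency,
with coefficients ±1; then H is bipartite, M has zero diagonal and rank 2, and H is complete
bipartite. Counting leaves K₃,₃ as the only exception (`IsAdmissible.choose_corank_le_or`): k = 4
with 9 < 10 edges.

If that exception arises in Gᶜ, either Gᶜ has a tenth edge or G is the join of a clique with two
triangles. An explicit matrix then gives μ(G) ≥ n - 5 (`card_le_mu_add_five`), so t ≤ 4 and C(t, 2)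
≤ 6. -/

/-! ### Symmetric matrices with one negative eigenvalue -/

theorem exists_eigenvectors {V : Type*} [Fintype V] [DecidableEq V] {M : Matrix V V ℝ}
    (hM : M.IsHermitian) :
    ∃ u : V → V → ℝ, (∀ k, M *ᵥ u k = hM.eigenvalues k • u k) ∧
      (∀ k l, u k ⬝ᵥ u l = if k = l then 1 else 0) ∧
      ∀ x, x = ∑ k, (u k ⬝ᵥ x) • u k := by
  refine ⟨fun k => (hM.eigenvectorBasis k).ofLp, hM.mulVec_eigenvectorBasis, fun k l => ?_,
    fun x => ?_⟩
  · have h := orthonormal_iff_ite.1 hM.eigenvectorBasis.orthonormal l k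
    rw [EuclideanSpace.inner_eq_star_dotProduct] at h
    simpa [eq_comm] using h
  · have h := congrArg WithLp.ofLp (hM.eigenvectorBasis.sum_repr' (WithLp.toLp 2 x))
    simp only [EuclideanSpace.inner_eq_star_dotProduct, WithLp.ofLp_sum, WithLp.ofLp_smul] at h
    simpa [dotProduct_comm] using h.symm

theorem dotProduct_mulVec_comm {V : Type*} [Fintype V] {M : Matrix V V ℝ}
    (hM : M.IsHermitian) (x y : V → ℝ) : x ⬝ᵥ M *ᵥ y = y ⬝ᵥ M *ᵥ x := by
  have h : Mᵀ = M := by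
    ext i j; simpa using congrFun (congrFun hM i) j
  rw [dotProduct_mulVec, dotProduct_comm, ← mulVec_transpose, h]

/-- A quadratic form that takes a negative value and becomes nonnegative after adding the square
of one linear form has exactly one negative eigenvalue. -/
theorem existsUnique_neg_eigenvalue_of_le {V : Type*} [Fintype V] [DecidableEq V]
    {M : Matrix V V ℝ} (hM : M.IsHermitian) (w : V → ℝ)
    (hw : ∀ x, 0 ≤ x ⬝ᵥ M *ᵥ x + (w ⬝ᵥ x) ^ 2) (hneg : ∃ x, x ⬝ᵥ M *ᵥ x < 0) :
    ∃! i, hM.eigenvalues i < 0 := by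
  obtain ⟨u, hu, ho, hs⟩ := exists_eigenvectors hM
  have hex : ∃ i, hM.eigenvalues i < 0 := by
    by_contra! h
    obtain ⟨x, hx⟩ := hneg
    have := (hM.posSemidef_iff_eigenvalues_nonneg.2 h).dotProduct_mulVec_nonneg x
    simp at this
    linarith
  obtain ⟨i, hi⟩ := hex
  refine ⟨i, hi, fun j hj => ?_⟩
  by_contra hij
  -- Two negative eigenvectors span a plane, which meets the hyperplane orthogonal to w; the form
  -- would be negative there. The bound at `u i` shows that the vector chosen is nonzero.
  have h0 : w ⬝ᵥ ((w ⬝ᵥ u j) • u i - (w ⬝ᵥ u i) • u j) = 0 := by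
    simp only [dotProduct_sub, dotProduct_smul, smul_eq_mul]; ring
  have h1 := hw ((w ⬝ᵥ u j) • u i - (w ⬝ᵥ u i) • u j)
  rw [h0] at h1
  have h2 := hw (u i)
  simp only [mulVec_sub, mulVec_smul, hu, dotProduct_sub, sub_dotProduct, dotProduct_smul,
    smul_dotProduct, smul_eq_mul, ho, hij, Ne.symm hij, if_true, if_false] at h1 h2
  have h3 : (w ⬝ᵥ u i) ^ 2 * hM.eigenvalues j + (w ⬝ᵥ u j) ^ 2 * hM.eigenvalues i ≥ 0 := by
    nlinarith
  nlinarith [sq_nonneg (w ⬝ᵥ u i), sq_nonneg (w ⬝ᵥ u j),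
    mul_nonneg (sq_nonneg (w ⬝ᵥ u j)) (neg_nonneg.2 hi.le), mul_pos_of_neg_of_neg hi hj]

theorem exists_neg_eigenvector {V : Type*} [Fintype V] [DecidableEq V]
    {M : Matrix V V ℝ} (hM : M.IsHermitian) (h : ∃! i, hM.eigenvalues i < 0) :
    ∃ (c : ℝ) (v : V → ℝ), c < 0 ∧ v ⬝ᵥ v = 1 ∧ M *ᵥ v = c • v ∧
      ∀ x, v ⬝ᵥ x = 0 → 0 ≤ x ⬝ᵥ M *ᵥ x ∧ (x ⬝ᵥ M *ᵥ x = 0 → M *ᵥ x = 0) := by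
  obtain ⟨u, hu, ho, hs⟩ := exists_eigenvectors hM
  obtain ⟨i, hi, hi'⟩ := h
  refine ⟨_, u i, hi, by simp [ho], hu i, fun x hx => ?_⟩
  have hMx : M *ᵥ x = ∑ k, (hM.eigenvalues k * (u k ⬝ᵥ x)) • u k := by
    conv_lhs => rw [hs x]
    rw [mulVec_sum]
    exact Finset.sum_congr rfl fun k _ => by rw [mulVec_smul, hu, smul_smul, mul_comm]
  have hq : x ⬝ᵥ M *ᵥ x = ∑ k, hM.eigenvalues k * (u k ⬝ᵥ x) ^ 2 := by
    rw [hMx, dotProduct_sum]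
    exact Finset.sum_congr rfl fun k _ => by
      rw [dotProduct_smul, dotProduct_comm x, smul_eq_mul]; ring
  have hnn : ∀ k ∈ Finset.univ, 0 ≤ hM.eigenvalues k * (u k ⬝ᵥ x) ^ 2 := by
    intro k _
    by_cases hk : k = i
    · subst hk; simp [hx]
    · exact mul_nonneg (not_lt.1 fun h => hk (hi' k h)) (sq_nonneg _)
  rw [hq]
  refine ⟨Finset.sum_nonneg hnn, fun h0 => ?_⟩
  rw [hMx]
  refine Finset.sum_eq_zero fun k hk => ?_
  have := (Finset.sum_eq_zero_iff_of_nonneg hnn).1 h0 k hk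
  rcases mul_eq_zero.1 this with h | h
  · simp [h]
  · simp [pow_eq_zero_iff] at h; simp [h]

theorem IsAdmissible.corank_lt_card {V : Type*} [Fintype V] {G : SimpleGraph V}
    {M : Matrix V V ℝ} (hM : IsAdmissible G M) : corank M < Fintype.card V := by
  let _ := Classical.decEq V
  obtain ⟨c, v, hc, hv, hMv, -⟩ := exists_neg_eigenvector hM.isHermitian
    hM.existsUnique_neg_eigenvalue
  have hne : LinearMap.ker M.mulVecLin ≠ ⊤ := by
    intro h
    have : v ∈ LinearMap.ker M.mulVecLin := h ▸ Submodule.mem_top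
    rw [LinearMap.mem_ker, mulVecLin_apply, hMv, smul_eq_zero] at this
    rcases this with h | h
    · exact hc.ne h
    · simp [h] at hv
  simpa [corank] using Submodule.finrank_lt hne

/-! ### Strong Arnold property and edge count -/

theorem exists_mul_eq_zero_of_corank {V : Type*} [Fintype V] (M : Matrix V V ℝ) :
    ∃ U : Matrix V (Fin (corank M)) ℝ, M * U = 0 ∧ ∀ c, U *ᵥ c = 0 → c = 0 := by
  let b : Module.Basis (Fin (corank M)) ℝ (LinearMap.ker M.mulVecLin) := Module.finBasis ℝ _
  have hb : LinearIndependent ℝ (fun k => (b k : V → ℝ)) :=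
    b.linearIndependent.map' (LinearMap.ker M.mulVecLin).subtype (Submodule.ker_subtype _)
  refine ⟨of fun i k => (b k : V → ℝ) i, ?_, fun c h => ?_⟩
  · ext i k
    exact congrFun (LinearMap.mem_ker.1 (b k).2) i
  · ext k
    refine Fintype.linearIndependent_iff.1 hb c ?_ k
    rw [← h]
    ext i
    simp [mulVec, dotProduct, mul_comm]

theorem eq_zero_of_mul_eq_zero {m n k : Type*} [Fintype n] {U : Matrix m n ℝ}
    (hU : ∀ c, U *ᵥ c = 0 → c = 0) {B : Matrix n k ℝ} (h : U * B = 0) : B = 0 := by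
  ext i j
  exact congrFun (hU (fun i => B i j) (funext fun a => congrFun (congrFun h a) j)) i

theorem card_diag_or_edge {V : Type*} [Fintype V] (G : SimpleGraph V)
    [Fintype {e : Sym2 V // e.IsDiag ∨ e ∈ G.edgeSet}] :
    Fintype.card {e : Sym2 V // e.IsDiag ∨ e ∈ G.edgeSet} =
      Fintype.card V + G.edgeSet.ncard := by
  classical
  have h : Disjoint (fun e : Sym2 V => e.IsDiag) (fun e => e ∈ G.edgeSet) := by
    rw [Pi.disjoint_iff]
    intro e
    rw [Prop.disjoint_iff]
    exact not_and.2 fun h h' => G.not_isDiag_of_mem_edgeSet h' h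
  rw [Fintype.card_subtype_or_disjoint _ _ h, Sym2.card_subtype_diag]
  congr 1
  rw [← Nat.card_coe_set_eq, Nat.card_eq_fintype_card]

/-- Symmetry makes the representative chosen for an unordered pair irrelevant, so X can be read as a
function on `Sym2 V`. -/
theorem apply_out_eq {V : Type*} {X : Matrix V V ℝ} (hX : X.IsSymm) {e : Sym2 V} {i j : V}
    (h : s(i, j) = e) : X e.out.1 e.out.2 = X i j := by
  have h' : s(e.out.1, e.out.2) = s(i, j) := by rw [h]; exact Quot.out_eq e
  rcases Sym2.eq_iff.1 h' with ⟨h1, h2⟩ | ⟨h1, h2⟩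
  · rw [h1, h2]
  · rw [h1, h2]; exact hX.apply i j

/-- The dimension count behind the strong Arnold property. -/
theorem IsAdmissible.exists_choose_corank_le {V : Type*} [Fintype V] {G : SimpleGraph V}
    {M : Matrix V V ℝ} (hM : IsAdmissible G M) :
    ∃ D : Submodule ℝ (V → ℝ),
      (∀ d ∈ D, (∀ i, d i * M i i = 0) ∧ ∀ i j, G.Adj i j → d i + d j = 0) ∧
      (corank M + 1).choose 2 ≤ G.edgeSet.ncard + Module.finrank ℝ D := by
  classical
  have hsymm : ∀ i j, M i j = M j i := fun i j => by
    simpa using (congrFun (congrFun hM.isHermitian i) j).symm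
  let S := {e : Sym2 V // e.IsDiag ∨ e ∈ G.edgeSet}
  -- Row i encodes the relation (MX)ᵢᵢ = 0 in terms of the entries of X on the diagonal and the
  -- edges.
  let N : Matrix V S ℝ := of fun i e => ∑ j, if s(i, j) = e.1 then M i j else 0
  obtain ⟨U, hMU, hU⟩ := exists_mul_eq_zero_of_corank M
  let A : (Sym2 (Fin (corank M)) → ℝ) → Matrix (Fin (corank M)) (Fin (corank M)) ℝ :=
    fun y => of fun k l => y s(k, l)
  let X : (Sym2 (Fin (corank M)) → ℝ) → Matrix V V ℝ := fun y => U * (A y * Uᵀ)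
  have hA : ∀ y, (A y).IsSymm := fun y => by
    ext k l; simp [A, Sym2.eq_swap]
  have hX : ∀ y, (X y).IsSymm := fun y => by
    simp only [X, Matrix.IsSymm, transpose_mul, transpose_transpose, (hA y).eq, Matrix.mul_assoc]
  have hMX : ∀ y, M * X y = 0 := fun y => by
    simp only [X]; rw [← Matrix.mul_assoc, hMU, Matrix.zero_mul]
  let F : (Sym2 (Fin (corank M)) → ℝ) →ₗ[ℝ] (S → ℝ) :=
    { toFun := fun y e => X y e.1.out.1 e.1.out.2
      map_add' := fun y z => by
        have : A (y + z) = A y + A z := by ext; simp [A]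
        ext e; simp [X, this, Matrix.add_mul, Matrix.mul_add]
      map_smul' := fun c y => by
        have : A (c • y) = c • A y := by ext; simp [A]
        ext e; simp [X, this] }
  have hF : Function.Injective F := by
    rw [← LinearMap.ker_eq_bot, LinearMap.ker_eq_bot']
    intro y hy
    have h0 : X y = 0 := by
      refine hM.strongArnold _ (hX y) (hMX y) fun i j hij => ?_
      have h := congrFun hy ⟨s(i, j), by simpa using hij⟩
      rw [← apply_out_eq (hX y) rfl]
      exact h
    have h1 : A y * Uᵀ = 0 := eq_zero_of_mul_eq_zero hU h0
    have h2 : A y = 0 := by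
      have h := congrArg transpose h1
      rw [transpose_mul, (hA y).eq, transpose_zero, transpose_transpose] at h
      exact eq_zero_of_mul_eq_zero hU h
    ext e
    induction e using Sym2.ind with
    | _ k l => exact congrFun (congrFun h2 k) l
  have hFN : ∀ y, N *ᵥ F y = 0 := by
    intro y
    ext i
    have h := congrFun (congrFun (hMX y) i) i
    rw [Matrix.mul_apply] at h
    simp only [mulVec, dotProduct, N, of_apply, Finset.sum_mul]
    rw [Finset.sum_comm]
    refine (Finset.sum_congr rfl fun j _ => ?_).trans h
    by_cases hij : i = j ∨ G.Adj i j
    · rw [Finset.sum_eq_single (⟨s(i, j), by simpa using hij⟩ : S)]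
      · rw [if_pos rfl, (hX y).apply i j]
        congr 1
        exact apply_out_eq (hX y) rfl
      · intro e _ he
        rw [if_neg (fun h => he (Subtype.ext h.symm)), zero_mul]
      · simp
    · rw [not_or] at hij
      simp [hM.apply_eq_zero i j hij.1 hij.2]
  -- D is the space of dependencies among the rows of N: rank N = |V| - dim D, and N has |V| + |E|
  -- columns, so dim ker N = |E| + dim D.
  refine ⟨LinearMap.ker Nᵀ.mulVecLin, fun d hd => ?_, ?_⟩
  · have hd' : ∀ e, ∑ i, d i * N i e = 0 := fun e => by
      have h := congrFun (LinearMap.mem_ker.1 hd) e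
      exact (Finset.sum_congr rfl fun i _ => mul_comm _ _).trans h
    constructor
    · intro i
      have h := hd' ⟨s(i, i), by simp⟩
      rw [Finset.sum_eq_single i] at h
      · simp only [N, of_apply] at h
        rwa [Finset.sum_eq_single i, if_pos rfl] at h
        · intro j _ hj; rw [if_neg]; simpa using hj
        · simp
      · intro k _ hk
        simp [N, hk]
      · simp
    · intro i j hij
      have hne := hij.ne
      have h := hd' ⟨s(i, j), by simpa using Or.inr hij⟩
      have key : ∀ k, N k ⟨s(i, j), by simpa using Or.inr hij⟩ =
          (if k = i then M i j else 0) + (if k = j then M i j else 0) := by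
        intro k
        simp only [N, of_apply, Sym2.eq_iff]
        by_cases h1 : k = i
        · subst h1; simp [hne]
        · by_cases h2 : k = j
          · subst h2; simp [h1, hsymm]
          · simp [h1, h2]
      simp only [key, mul_add, Finset.sum_add_distrib, mul_ite, mul_zero, Finset.sum_ite_eq',
        Finset.mem_univ, if_true] at h
      rw [← add_mul] at h
      exact (mul_eq_zero.1 h).resolve_right (hM.apply_neg i j hij).ne
  · have h1 : (corank M + 1).choose 2 ≤ Module.finrank ℝ (LinearMap.ker N.mulVecLin) := by
      have h := LinearMap.finrank_le_finrank_of_injective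
        (f := F.codRestrict (LinearMap.ker N.mulVecLin) (fun y => LinearMap.mem_ker.2 (hFN y)))
        (fun a b hab => hF (congrArg Subtype.val hab))
      simpa [Sym2.card] using h
    have h2 := LinearMap.finrank_range_add_finrank_ker N.mulVecLin
    have h3 := LinearMap.finrank_range_add_finrank_ker Nᵀ.mulVecLin
    have h4 := N.rank_transpose
    simp only [Matrix.rank] at h4
    rw [Module.finrank_fintype_fun_eq_card] at h2 h3
    have h5 : Fintype.card S = _ := card_diag_or_edge G
    omega

/-! ### The bipartite case and the exception K₃,₃ -/

theorem finrank_eq_zero_or_exists_signs {V : Type*} [Fintype V] {G : SimpleGraph V}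
    (hG : G.Connected) (D : Submodule ℝ (V → ℝ))
    (hD : ∀ d ∈ D, ∀ i j, G.Adj i j → d i + d j = 0) :
    Module.finrank ℝ D = 0 ∨ Module.finrank ℝ D ≤ 1 ∧
      ∃ d ∈ D, (∀ i, d i = 1 ∨ d i = -1) := by
  have hzero : ∀ d ∈ D, ∀ i j, d i = d j ∨ d i = -d j := by
    intro d hd i j
    obtain ⟨p⟩ := hG.preconnected i j
    induction p with
    | nil => exact Or.inl rfl
    | cons h p ih =>
      have := hD d hd _ _ h
      rcases ih with h' | h'
      · right; linarith
      · left; linarith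
  obtain ⟨i⟩ := hG.nonempty
  by_cases h : ∃ d ∈ D, d i ≠ 0
  · right
    constructor
    · have hinj : Function.Injective ((LinearMap.proj i : (V → ℝ) →ₗ[ℝ] ℝ) ∘ₗ D.subtype) := by
        rw [← LinearMap.ker_eq_bot, LinearMap.ker_eq_bot']
        intro d h0
        ext j
        have h0' : d.1 i = 0 := h0
        rcases hzero d d.2 j i with h | h <;> simp [h, h0']
      simpa using LinearMap.finrank_le_finrank_of_injective hinj
    · obtain ⟨d, hd, hi⟩ := h
      refine ⟨(d i)⁻¹ • d, D.smul_mem _ hd, fun j => ?_⟩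
      rcases hzero d hd j i with h | h
      · left; simp [h, hi]
      · right; simp [h, hi]
  · left
    push Not at h
    have : D = ⊥ := by
      rw [eq_bot_iff]
      intro d hd
      rw [Submodule.mem_bot]
      ext j
      rcases hzero d hd j i with h' | h' <;> simp [h', h d hd]
    simp [this]

/-- An admissible matrix of a connected bipartite graph with zero diagonal has rank two, and the
graph is complete bipartite. -/
theorem IsAdmissible.corank_add_two_of_signs {V : Type*} [Fintype V] {G : SimpleGraph V}
    {M : Matrix V V ℝ} (hM : IsAdmissible G M) (hG : G.Connected) {d : V → ℝ}
    (hd : ∀ i, d i = 1 ∨ d i = -1) (hdiag : ∀ i, M i i = 0)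
    (hadj : ∀ i j, G.Adj i j → d i + d j = 0) :
    (∀ i j, d i ≠ d j → G.Adj i j) ∧ (∃ i j, G.Adj i j) ∧ corank M + 2 = Fintype.card V := by
  classical
  obtain ⟨c, v, hc, hv, hMv, hpos⟩ := exists_neg_eigenvector hM.isHermitian
    hM.existsUnique_neg_eigenvalue
  have hdd : ∀ i, d i * d i = 1 := fun i => by rcases hd i with h | h <;> simp [h]
  have hadj' : ∀ i j, M i j ≠ 0 → G.Adj i j := fun i j h => by
    by_contra hn
    by_cases hij : i = j
    · subst hij; exact h (hdiag i)
    · exact h (hM.apply_eq_zero i j hij hn)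
  -- M anticommutes with the diagonal matrix of signs, so its spectrum is symmetric about 0: there
  -- is also just one positive eigenvalue.
  have hMd : ∀ x, M *ᵥ (d * x) = -(d * M *ᵥ x) := by
    intro x
    ext i
    simp only [mulVec, dotProduct, Pi.mul_apply, Pi.neg_apply, Finset.mul_sum]
    rw [← Finset.sum_neg_distrib]
    refine Finset.sum_congr rfl fun j _ => ?_
    by_cases h : M i j = 0
    · simp [h]
    · rw [eq_neg_of_add_eq_zero_right (hadj i j (hadj' i j h))]; ring
  have hdot : ∀ x y : V → ℝ, (d * x) ⬝ᵥ (d * y) = x ⬝ᵥ y := by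
    intro x y
    refine Finset.sum_congr rfl fun i _ => ?_
    rw [Pi.mul_apply, Pi.mul_apply, mul_mul_mul_comm, hdd, one_mul]
  have hddx : ∀ x : V → ℝ, d * (d * x) = x := fun x => by
    ext i; simp [← mul_assoc, hdd]
  set w := d * v with hw
  have hMw : M *ᵥ w = -c • w := by rw [hw, hMd, hMv]; ext i; simp
  have hww : w ⬝ᵥ w = 1 := by rw [hw, hdot, hv]
  have hvw : v ⬝ᵥ w = 0 := by
    have h := dotProduct_mulVec_comm hM.isHermitian v w
    rw [hMw, hMv, dotProduct_smul, dotProduct_smul, dotProduct_comm w v, smul_eq_mul,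
      smul_eq_mul] at h
    have : c * (v ⬝ᵥ w) = 0 := by linarith
    exact (mul_eq_zero.1 this).resolve_left hc.ne
  have hwv : w ⬝ᵥ v = 0 := by rw [dotProduct_comm, hvw]
  -- The form is nonnegative at both x and dx, and its values there are opposite.
  have hker : ∀ x, v ⬝ᵥ x = 0 → w ⬝ᵥ x = 0 → M *ᵥ x = 0 := by
    intro x h1 h2
    have h3 := hpos x h1
    have h4 := hpos (d * x) (by rw [← hdot, hddx]; exact h2)
    rw [hMd, dotProduct_neg, hdot] at h4
    exact h3.2 (le_antisymm (by linarith [h4.1]) h3.1)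
  have hform : ∀ x, M *ᵥ x = (c * (v ⬝ᵥ x)) • v - (c * (w ⬝ᵥ x)) • w := by
    intro x
    have h := hker (x - (v ⬝ᵥ x) • v - (w ⬝ᵥ x) • w)
      (by simp [dotProduct_sub, hv, hvw]) (by simp [dotProduct_sub, hww, hwv])
    rw [mulVec_sub, mulVec_sub, mulVec_smul, mulVec_smul, hMv, hMw] at h
    ext i
    have := congrFun h i
    simp only [Pi.sub_apply, Pi.smul_apply, smul_eq_mul, Pi.zero_apply] at this ⊢
    linarith
  have hentry : ∀ i j, M i j = c * (v j * v i) - c * ((d j * v j) * (d i * v i)) := by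
    intro i j
    have := congrFun (hform (Pi.single j 1)) i
    simp [hw] at this
    rw [this]; ring
  have hex : ∃ i j, G.Adj i j := by
    by_contra! h
    have h0 : M *ᵥ v = 0 := by
      ext i
      refine Finset.sum_eq_zero fun j _ => ?_
      have : M i j = 0 := by
        by_contra hne
        exact h i j (hadj' i j hne)
      simp [this]
    rw [hMv, smul_eq_zero] at h0
    rcases h0 with h0 | h0
    · exact hc.ne h0
    · simp [h0] at hv
  -- If v vanishes at i, so does the whole row i of M = c(vvᵀ - wwᵀ), yet i has a neighbour.
  have hv0 : ∀ i, v i ≠ 0 := by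
    intro i hi
    obtain ⟨a, b, hab⟩ := hex
    have : Nontrivial V := ⟨a, b, hab.ne⟩
    obtain ⟨j, hj⟩ := hG.preconnected.exists_adj_of_nontrivial i
    have := hM.apply_neg i j hj
    rw [hentry, hi] at this
    simp at this
  refine ⟨fun i j hij => hadj' i j ?_, hex, ?_⟩
  · have hprod : d i * d j = -1 := by
      rcases hd i with h | h <;> rcases hd j with h' | h' <;> simp [h, h'] at hij ⊢
    have : M i j = 2 * c * (v i * v j) := by
      rw [hentry]; linear_combination (-c * v i * v j) * hprod
    rw [this]
    exact mul_ne_zero (mul_ne_zero two_ne_zero hc.ne) (mul_ne_zero (hv0 i) (hv0 j))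
  · let φ : (V → ℝ) →ₗ[ℝ] ℝ × ℝ :=
      (dotProductBilin ℝ ℝ v).prod (dotProductBilin ℝ ℝ w)
    have hφ : ∀ x, φ x = (v ⬝ᵥ x, w ⬝ᵥ x) := fun x => rfl
    have hsurj : LinearMap.range φ = ⊤ := by
      rw [LinearMap.range_eq_top]
      rintro ⟨a, b⟩
      refine ⟨a • v + b • w, ?_⟩
      simp [hφ, dotProduct_add, hv, hvw, hww, hwv]
    have hk : LinearMap.ker M.mulVecLin = LinearMap.ker φ := by
      ext x
      simp only [LinearMap.mem_ker, mulVecLin_apply, hφ, Prod.mk_eq_zero]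
      refine ⟨fun h => ?_, fun h => hker x h.1 h.2⟩
      have h1 := dotProduct_mulVec_comm hM.isHermitian v x
      have h2 := dotProduct_mulVec_comm hM.isHermitian w x
      rw [h, hMv, dotProduct_smul, dotProduct_zero, dotProduct_comm x, smul_eq_mul, zero_eq_mul]
        at h1
      rw [h, hMw, dotProduct_smul, dotProduct_zero, dotProduct_comm x, smul_eq_mul, zero_eq_mul]
        at h2
      exact ⟨h1.resolve_left hc.ne, h2.resolve_left (neg_ne_zero.2 hc.ne)⟩
    have h := LinearMap.finrank_range_add_finrank_ker φ
    rw [hsurj, ← hk] at h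
    simp at h
    rw [corank]; omega

theorem ncard_edgeSet_of_adj_iff_ne {V : Type*} [Fintype V] {G : SimpleGraph V} {f : V → Bool}
    (hf : ∀ i j, G.Adj i j ↔ f i ≠ f j) :
    G.edgeSet.ncard =
      (Finset.univ.filter fun i => f i = true).card *
        (Finset.univ.filter fun i => f i = false).card := by
  classical
  have hb : G.IsBipartiteWith (Finset.univ.filter fun i => f i = true : Finset V)
      (Finset.univ.filter fun i => f i = false : Finset V) := by
    constructor
    · rw [Finset.disjoint_coe, Finset.disjoint_filter]
      simp
    · intro i j h
      have := (hf i j).1 h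
      revert this
      cases hi : f i <;> cases hj : f j <;> simp [hi, hj]
  have h := SimpleGraph.isBipartiteWith_sum_degrees_eq_card_edges hb
  rw [Set.ncard_eq_toFinset_card', ← SimpleGraph.edgeFinset, ← h, ← smul_eq_mul,
    ← Finset.sum_const]
  refine Finset.sum_congr rfl fun i hi => ?_
  rw [← SimpleGraph.card_neighborFinset_eq_degree]
  congr 1
  ext j
  have hi' : f i = true := by simpa using hi
  simp [hf, hi']

theorem eq_two_of_sq_add_sq {p q : ℕ} (h : p * p + q * q = p + q + 4) : p = 2 ∧ q = 2 := by
  have hp : p ≤ 2 := by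
    have := Nat.le_mul_self q
    by_contra!
    nlinarith
  have hq : q ≤ 2 := by
    have := Nat.le_mul_self p
    by_contra!
    nlinarith
  interval_cases p <;> interval_cases q <;> simp_all

theorem IsAdmissible.choose_corank_le_or {V : Type*} [Fintype V] {G : SimpleGraph V}
    {M : Matrix V V ℝ} (hM : IsAdmissible G M) (hG : G.Connected) :
    (corank M + 1).choose 2 ≤ G.edgeSet.ncard ∨
      corank M = 4 ∧ ∃ f : V → Bool, (∀ i j, G.Adj i j ↔ f i ≠ f j) ∧
        (Finset.univ.filter fun i => f i = true).card = 3 ∧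
        (Finset.univ.filter fun i => f i = false).card = 3 := by
  classical
  obtain ⟨D, hD, hle⟩ := hM.exists_choose_corank_le
  rcases finrank_eq_zero_or_exists_signs hG D (fun d hd => (hD d hd).2) with h | ⟨h, d, hdD, hd⟩
  · left; omega
  by_cases hlt : (corank M + 1).choose 2 ≤ G.edgeSet.ncard
  · exact Or.inl hlt
  right
  obtain ⟨hdiag, hadj⟩ := hD d hdD
  have hd0 : ∀ i, d i ≠ 0 := fun i => by rcases hd i with h | h <;> simp [h]
  obtain ⟨hc, ⟨a, b, hab⟩, hcard⟩ := hM.corank_add_two_of_signs hG hd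
    (fun i => (mul_eq_zero.1 (hdiag i)).resolve_left (hd0 i)) hadj
  let f : V → Bool := fun i => decide (d i = 1)
  have hff : ∀ i j, f i ≠ f j ↔ d i ≠ d j := by
    intro i j
    rcases hd i with h | h <;> rcases hd j with h' | h' <;> simp [f, h, h'] <;> norm_num
  have hf : ∀ i j, G.Adj i j ↔ f i ≠ f j := by
    intro i j
    rw [hff]
    refine ⟨fun h h' => hd0 j ?_, hc i j⟩
    have := hadj i j h
    linarith
  have hE := ncard_edgeSet_of_adj_iff_ne hf
  have hn : (Finset.univ.filter fun i => f i = true).card +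
      (Finset.univ.filter fun i => f i = false).card = Fintype.card V := by
    have := Finset.card_filter_add_card_filter_not (s := (Finset.univ : Finset V))
      (fun i => f i = true)
    simpa using this
  have hp : 0 < (Finset.univ.filter fun i => f i = true).card *
      (Finset.univ.filter fun i => f i = false).card := by
    rw [← hE, Set.ncard_pos]
    exact ⟨s(a, b), hab⟩
  generalize hpt : (Finset.univ.filter fun i => f i = true).card = p at *
  generalize hq : (Finset.univ.filter fun i => f i = false).card = q at *
  -- From here the parts have sizes p + 1 and q + 1. Failure of the bound forces C(p + q + 1, 2) =
  -- (p + 1)(q + 1) + 1, that is, p² + q² = p + q + 4.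
  obtain ⟨p, rfl⟩ := Nat.exists_eq_succ_of_ne_zero (left_ne_zero_of_mul hp.ne')
  obtain ⟨q, rfl⟩ := Nat.exists_eq_succ_of_ne_zero (right_ne_zero_of_mul hp.ne')
  have hm : corank M = p + q := by omega
  have hch : (corank M + 1).choose 2 = (p + 1) * (q + 1) + 1 := by
    simp only [Nat.succ_eq_add_one] at hE; omega
  rw [hm, Nat.choose_two_right] at hch
  have h3 : (p + q + 1) * (p + q) = 2 * ((p + 1) * (q + 1) + 1) := by
    have := Nat.div_mul_cancel (Nat.even_mul_succ_self (p + q)).two_dvd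
    simp only [Nat.add_sub_cancel] at hch
    rw [mul_comm (p + q + 1)] at hch ⊢
    rw [← hch]
    rw [mul_comm 2]
    exact this.symm
  obtain ⟨rfl, rfl⟩ := eq_two_of_sq_add_sq (p := p) (q := q) (by linarith)
  exact ⟨hm, f, hf, hpt, hq⟩

/-! ### Explicit admissible matrices -/

theorem exists_isAdmissible_of_complete {V : Type*} [Fintype V] [Nonempty V] {G : SimpleGraph V}
    (hG : ∀ i j, i ≠ j → G.Adj i j) :
    ∃ M : Matrix V V ℝ, IsAdmissible G M ∧ Fintype.card V ≤ corank M + 1 := by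
  let M : Matrix V V ℝ := of fun _ _ => -1
  have hmul : ∀ x i, (M *ᵥ x) i = -∑ j, x j := fun x i => by
    simp [M, mulVec, dotProduct]
  have hform : ∀ x, x ⬝ᵥ M *ᵥ x = -(∑ j, x j) ^ 2 := fun x => by
    simp only [dotProduct, hmul]
    rw [← Finset.sum_mul]; ring
  have hherm : M.IsHermitian := by ext; simp [M]
  refine ⟨M, ⟨hherm, fun i j h h' => absurd (hG i j h) h', fun _ _ _ => by simp [M], ?_,
    fun X _ _ h => ?_⟩, ?_⟩
  · classical
    refine @existsUnique_neg_eigenvalue_of_le V _ (Classical.decEq V) M hherm 1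
      (fun x => by rw [hform]; simp [dotProduct]) ?_
    obtain ⟨i⟩ := ‹Nonempty V›
    exact ⟨Pi.single i 1, by simp [M]⟩
  · ext i j
    by_cases hij : i = j
    · exact h i j (Or.inl hij)
    · exact h i j (Or.inr (hG i j hij))
  · let φ : (V → ℝ) →ₗ[ℝ] ℝ := ∑ j, LinearMap.proj j
    have hk : LinearMap.ker φ ≤ LinearMap.ker M.mulVecLin := by
      intro x hx
      have hx' : ∑ j, x j = 0 := by simpa [φ] using hx
      rw [LinearMap.mem_ker]
      ext i
      simp [hmul, hx']
    have h1 := LinearMap.finrank_range_add_finrank_ker φ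
    have h2 := Submodule.finrank_mono hk
    have h3 := Submodule.finrank_le (LinearMap.range φ)
    simp only [Module.finrank_fintype_fun_eq_card, Module.finrank_self] at h1 h3
    rw [corank]; omega

theorem fin_three_cases (k : Fin 3) : k = 0 ∨ k = 1 ∨ k = 2 := by
  fin_cases k <;> simp

/-- An admissible matrix for the join of a clique with the disjoint union of a triangle and a
clique. -/
theorem exists_isAdmissible_of_adj_iff {V : Type*} [Fintype V] {G : SimpleGraph V}
    (f : V → Fin 3)
    (hG : ∀ i j, G.Adj i j ↔ i ≠ j ∧ ¬(f i = 0 ∧ f j = 1) ∧ ¬(f i = 1 ∧ f j = 0))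
    (hcard : (Finset.univ.filter fun i => f i = 0).card = 3) (hex : ∃ i, f i = 2) :
    ∃ M : Matrix V V ℝ, IsAdmissible G M ∧ Fintype.card V ≤ corank M + 4 := by
  classical
  -- With Sₖ the sum of x over class k, these entries and the 6 added on the triangle make the form
  -- equal to (6∑x² - 2S₀²) + (S₀ - S₂)² - (S₁ + 2S₂)², where ∑ runs over class 0. By Cauchy–Schwarz
  -- on three vertices the first bracket is nonnegative.
  let q : Fin 3 → Fin 3 → ℝ := ![![-1, 0, -1], ![0, -1, -2], ![-1, -2, -3]]
  let M : Matrix V V ℝ := of fun i j => q (f i) (f j) + if i = j ∧ f i = 0 then 6 else 0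
  let S : Fin 3 → (V → ℝ) → ℝ := fun k x => ∑ j with f j = k, x j
  have hsum : ∀ y : V → ℝ, ∑ i, y i = S 0 y + S 1 y + S 2 y := by
    intro y
    rw [← Finset.sum_fiberwise Finset.univ f y, Fin.sum_univ_three]
  have hS : ∀ k (y z : V → ℝ), (∀ i, f i = k → y i = z i) → S k y = S k z := fun k y z h =>
    Finset.sum_congr rfl fun i hi => h i (Finset.mem_filter.1 hi).2
  have hSc : ∀ k (c : ℝ) (z : V → ℝ), S k (fun i => c * z i) = c * S k z := fun k c z =>
    (Finset.mul_sum _ _ _).symm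
  have hmul : ∀ x i, (M *ᵥ x) i = q (f i) 0 * S 0 x + q (f i) 1 * S 1 x + q (f i) 2 * S 2 x +
      if f i = 0 then 6 * x i else 0 := by
    intro x i
    have h1 : (M *ᵥ x) i = ∑ j, q (f i) (f j) * x j +
        ∑ j, (if i = j ∧ f i = 0 then 6 else 0) * x j := by
      simp [M, mulVec, dotProduct, add_mul, Finset.sum_add_distrib]
    rw [h1, hsum]
    congr 1
    · rw [← hSc, ← hSc, ← hSc]
      congr 1
      · congr 1 <;> exact hS _ _ _ fun j hj => by rw [hj]
      · exact hS _ _ _ fun j hj => by rw [hj]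
    · by_cases h : f i = 0 <;> simp [h]
  have h0 : ∀ x i, f i = 0 → (M *ᵥ x) i = 6 * x i - (S 0 x + S 2 x) := fun x i h => by
    simp [hmul, h, q]; ring
  have h1 : ∀ x i, f i = 1 → (M *ᵥ x) i = -(S 1 x + 2 * S 2 x) := fun x i h => by
    simp [hmul, h, q]; ring
  have h2 : ∀ x i, f i = 2 → (M *ᵥ x) i = -(S 0 x + 2 * S 1 x + 3 * S 2 x) := fun x i h => by
    simp [hmul, h, q]; ring
  have hform : ∀ x, x ⬝ᵥ M *ᵥ x = 6 * S 0 (fun i => x i ^ 2) - (S 0 x + S 2 x) * S 0 x -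
      (S 1 x + 2 * S 2 x) * S 1 x - (S 0 x + 2 * S 1 x + 3 * S 2 x) * S 2 x := by
    intro x
    have e0 : S 0 (fun i => x i * (M *ᵥ x) i) =
        6 * S 0 (fun i => x i ^ 2) + -(S 0 x + S 2 x) * S 0 x := by
      rw [← hSc, ← hSc]
      refine (hS 0 _ (fun i => 6 * x i ^ 2 + -(S 0 x + S 2 x) * x i) fun i hi => ?_).trans
        Finset.sum_add_distrib
      rw [h0 x i hi]; ring
    have e1 : S 1 (fun i => x i * (M *ᵥ x) i) = -(S 1 x + 2 * S 2 x) * S 1 x := by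
      rw [← hSc]
      exact hS 1 _ _ fun i hi => by rw [h1 x i hi]; ring
    have e2 : S 2 (fun i => x i * (M *ᵥ x) i) = -(S 0 x + 2 * S 1 x + 3 * S 2 x) * S 2 x := by
      rw [← hSc]
      exact hS 2 _ _ fun i hi => by rw [h2 x i hi]; ring
    rw [dotProduct, hsum, e0, e1, e2]; ring
  have hqsymm : ∀ k l, q k l = q l k := by
    intro k l; fin_cases k <;> fin_cases l <;> simp [q]
  have hherm : M.IsHermitian := by
    ext i j
    by_cases hij : i = j
    · subst hij; simp [M]
    · simp [M, hij, Ne.symm hij, hqsymm (f j)]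
  refine ⟨M, ⟨hherm, fun i j hij h => ?_, fun i j h => ?_, ?_, fun X hX hMX h => ?_⟩, ?_⟩
  · rw [hG] at h
    by_cases ha : f i = 0 ∧ f j = 1
    · simp [M, hij, ha.1, ha.2, q]
    · by_cases hb : f i = 1 ∧ f j = 0
      · simp [M, hb.1, hb.2, q]
      · exact absurd ⟨hij, ha, hb⟩ h
  · obtain ⟨hij, ha, hb⟩ := (hG i j).1 h
    rcases fin_three_cases (f i) with hi | hi | hi <;>
      rcases fin_three_cases (f j) with hj | hj | hj <;>
      simp [M, hij, hi, hj, q] at ha hb ⊢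
  · refine @existsUnique_neg_eigenvalue_of_le V _ (Classical.decEq V) M hherm
      (fun i => if f i = 0 then 0 else if f i = 1 then 1 else 2) (fun x => ?_) ?_
    · have hw : (fun i => if f i = 0 then 0 else if f i = 1 then 1 else 2 : V → ℝ) ⬝ᵥ x =
          S 1 x + 2 * S 2 x := by
        rw [dotProduct, hsum, hS 0 _ (fun i => 0 * x i) fun i hi => by simp [hi],
          hS 1 _ (fun i => 1 * x i) fun i hi => by simp [hi],
          hS 2 _ (fun i => 2 * x i) fun i hi => by simp [hi], hSc, hSc, hSc]
        ring
      rw [hw, hform]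
      have hcs : S 0 x ^ 2 ≤ 3 * S 0 (fun i => x i ^ 2) := by
        have := sq_sum_le_card_mul_sum_sq (s := Finset.univ.filter fun i => f i = 0) (f := x)
        rw [hcard] at this
        exact_mod_cast this
      nlinarith [sq_nonneg (S 0 x - S 2 x)]
    · obtain ⟨i, hi⟩ := hex
      refine ⟨Pi.single i 1, ?_⟩
      simp [M, hi, q]
  -- For j in class 1, column j of X lives on the triangle. There MX = 0 makes six times each entry
  -- equal to the sum s of the three entries, so 6s = 3s.
  · have key : ∀ i j, f i = 0 → f j = 1 → X i j = 0 := by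
      intro i j hi hj
      have hC : S 2 (fun k => X k j) = 0 := by
        refine Finset.sum_eq_zero fun k hk => ?_
        have hk' := (Finset.mem_filter.1 hk).2
        refine h k j (Or.inr ((hG k j).2 ⟨?_, ?_, ?_⟩))
        · rintro rfl; simp [hk'] at hj
        · simp [hk']
        · simp [hk']
      have hA : ∀ k, f k = 0 → 6 * X k j = S 0 (fun k => X k j) := by
        intro k hk
        have := congrFun (congrFun hMX k) j
        have h' := h0 (fun k => X k j) k hk
        rw [hC] at h'
        have h'' : (M *ᵥ fun k => X k j) k = 0 := this
        linarith
      have hA' : 6 * S 0 (fun k => X k j) = 3 * S 0 (fun k => X k j) := by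
        conv_lhs => rw [← hSc, hS 0 _ (fun _ => S 0 (fun k => X k j)) hA]
        simp only [S, Finset.sum_const, hcard]
        simp
      have := hA i hi
      linarith
    ext i j
    by_cases hij : i = j ∨ G.Adj i j
    · exact h i j hij
    · rw [not_or, hG] at hij
      by_cases ha : f i = 0 ∧ f j = 1
      · exact key i j ha.1 ha.2
      · by_cases hb : f i = 1 ∧ f j = 0
        · rw [← hX.apply]; exact key j i hb.2 hb.1
        · exact absurd ⟨hij.1, ha, hb⟩ hij.2
  · let s : Fin 3 → (V → ℝ) →ₗ[ℝ] ℝ := fun k => ∑ j with f j = k, LinearMap.proj j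
    have hs : ∀ k x, s k x = S k x := fun k x => by simp [s, S]
    -- Four equations suffice for the kernel: x = S₂/3 at each triangle vertex, and S₁ + 2S₂ = 0.
    let φ : (V → ℝ) →ₗ[ℝ] ({i // f i = 0} → ℝ) × ℝ :=
      (LinearMap.pi fun i => LinearMap.proj i.1 - (1 / 3 : ℝ) • s 2).prod (s 1 + (2 : ℝ) • s 2)
    have hk : LinearMap.ker φ ≤ LinearMap.ker M.mulVecLin := by
      intro x hx
      have hx1 : ∀ i, f i = 0 → x i = 1 / 3 * S 2 x := fun i hi => by
        have := congrFun (congrArg Prod.fst (LinearMap.mem_ker.1 hx)) ⟨i, hi⟩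
        simp [φ, hs] at this
        linarith
      have hx2 : S 1 x + 2 * S 2 x = 0 := by
        have := congrArg Prod.snd (LinearMap.mem_ker.1 hx)
        simpa [φ, hs] using this
      have hx3 : S 0 x = S 2 x := by
        rw [hS 0 x (fun _ => 1 / 3 * S 2 x) hx1]
        simp only [S, Finset.sum_const, hcard]
        simp
      rw [LinearMap.mem_ker]
      ext i
      rw [mulVecLin_apply, Pi.zero_apply]
      rcases fin_three_cases (f i) with hi | hi | hi
      · rw [h0 x i hi, hx1 i hi, hx3]; ring
      · rw [h1 x i hi, hx2]; simp
      · rw [h2 x i hi, hx3]; linarith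
    have e1 := LinearMap.finrank_range_add_finrank_ker φ
    have e2 := Submodule.finrank_mono hk
    have e3 := Submodule.finrank_le (LinearMap.range φ)
    simp only [Module.finrank_fintype_fun_eq_card, Module.finrank_self, Module.finrank_prod,
      Fintype.card_subtype, hcard] at e1 e3
    rw [corank]; omega

/-! ### Passing between a graph and its components -/

theorem IsAdmissible.corank_le_mu {V : Type*} [Fintype V] {G : SimpleGraph V}
    {C : G.ConnectedComponent} [h : Fintype C] {M : Matrix C C ℝ}
    (hM : IsAdmissible C.toSimpleGraph M) : corank M ≤ mu G := by
  classical
  have h1 : corank M ≤ muConnected C.toSimpleGraph :=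
    le_csSup (bddAbove_coranks _) ⟨M, hM, rfl⟩
  refine h1.trans ?_
  unfold mu
  convert le_ciSup (Set.finite_range fun C : G.ConnectedComponent =>
    muConnected C.toSimpleGraph).bddAbove C

/-- A nonzero value rules out the default `sSup ∅ = 0`, so the supremum is attained. -/
theorem exists_corank_eq_mu {V : Type*} [Fintype V] [Nonempty V] (G : SimpleGraph V)
    (h : mu G ≠ 0) :
    ∃ (C : G.ConnectedComponent) (_ : Fintype C) (M : Matrix C C ℝ),
      IsAdmissible C.toSimpleGraph M ∧ corank M = mu G := by
  classical
  have : Nonempty G.ConnectedComponent := ‹Nonempty V›.map G.connectedComponentMk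
  obtain ⟨C, hC⟩ := exists_eq_ciSup_of_finite
    (f := fun C : G.ConnectedComponent => muConnected C.toSimpleGraph)
  have hC' : muConnected C.toSimpleGraph = mu G := by
    unfold mu
    convert hC
  have hne : (coranks C.toSimpleGraph).Nonempty := by
    by_contra hne
    rw [Set.not_nonempty_iff_eq_empty] at hne
    rw [muConnected, hne, csSup_empty] at hC'
    exact h hC'.symm
  obtain ⟨M, hM, hk⟩ := Nat.sSup_mem hne (bddAbove_coranks _)
  exact ⟨C, inferInstance, M, hM, hk.trans hC'⟩

theorem mu_lt_card {V : Type*} [Fintype V] [Nonempty V] (G : SimpleGraph V) :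
    mu G < Fintype.card V := by
  by_cases h : mu G = 0
  · rw [h]; exact Fintype.card_pos
  · obtain ⟨C, _, M, hM, hk⟩ := exists_corank_eq_mu G h
    rw [← hk]
    exact hM.corank_lt_card.trans_le (Fintype.card_le_of_injective _ Subtype.val_injective)

theorem image_edgeSet_toSimpleGraph_subset {V : Type*} {G : SimpleGraph V}
    (C : G.ConnectedComponent) :
    Sym2.map (Subtype.val : C → V) '' C.toSimpleGraph.edgeSet ⊆ G.edgeSet := by
  rintro _ ⟨e, he, rfl⟩
  induction e using Sym2.ind with
  | _ i j => exact (C.toSimpleGraph_adj i.2 j.2).1 he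

theorem ncard_edgeSet_toSimpleGraph_le {V : Type*} [Finite V] {G : SimpleGraph V}
    (C : G.ConnectedComponent) : C.toSimpleGraph.edgeSet.ncard ≤ G.edgeSet.ncard := by
  rw [← Set.ncard_image_of_injective _ (Sym2.map.injective (Subtype.val_injective (p := (· ∈ C))))]
  exact Set.ncard_le_ncard (image_edgeSet_toSimpleGraph_subset C) (Set.toFinite _)

theorem mem_of_adj_of_ncard_le {V : Type*} [Finite V] {G : SimpleGraph V}
    (C : G.ConnectedComponent) (h : G.edgeSet.ncard ≤ C.toSimpleGraph.edgeSet.ncard) {i j : V}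
    (hij : G.Adj i j) : i ∈ C := by
  rw [← Set.ncard_image_of_injective _
    (Sym2.map.injective (Subtype.val_injective (p := (· ∈ C))))] at h
  have heq := Set.eq_of_subset_of_ncard_le (image_edgeSet_toSimpleGraph_subset C) h
    (Set.toFinite _)
  have hm : s(i, j) ∈ G.edgeSet := hij
  rw [← heq] at hm
  obtain ⟨e, -, he⟩ := hm
  have hi : i ∈ Sym2.map (Subtype.val : C → V) e := he ▸ Sym2.mem_mk_left i j
  obtain ⟨a, -, rfl⟩ := Sym2.mem_map.1 hi
  exact a.2

theorem card_filter_subtype {V : Type*} [Fintype V] {s : V → Prop} [Fintype {i // s i}]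
    (p : V → Prop) [DecidablePred p] (q : {i // s i} → Prop) [DecidablePred q]
    (hp : ∀ i, p i → s i) (hpq : ∀ i, q i ↔ p i.1) :
    (Finset.univ.filter q).card = (Finset.univ.filter p).card := by
  refine Finset.card_bij (fun i _ => i.1) ?_ ?_ ?_
  · intro i hi
    simpa [hpq] using hi
  · intro i _ j _ h
    exact Subtype.ext h
  · intro i hi
    have hi' : p i := by simpa using hi
    exact ⟨⟨i, hp i hi'⟩, by simpa [hpq] using hi', rfl⟩

/-- If the edges outside `G` form exactly a copy of `K₃,₃`, then `μ(G) ≥ |V(G)| - 5`. -/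
theorem card_le_mu_add_five {V : Type*} [Fintype V] {G : SimpleGraph V} (f : V → Fin 3)
    (hG : ∀ i j, G.Adj i j ↔ i ≠ j ∧ ¬(f i = 0 ∧ f j = 1) ∧ ¬(f i = 1 ∧ f j = 0))
    (h0 : (Finset.univ.filter fun i => f i = 0).card = 3)
    (h1 : (Finset.univ.filter fun i => f i = 1).card = 3) : Fintype.card V ≤ mu G + 5 := by
  classical
  obtain ⟨a, b, ha, hb, hab⟩ : ∃ a b, f a = 0 ∧ f b = 0 ∧ a ≠ b := by
    have hlt : 1 < (Finset.univ.filter fun i => f i = 0).card := by omega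
    obtain ⟨a, ha, b, hb, hab⟩ := Finset.one_lt_card.1 hlt
    exact ⟨a, b, by simpa using ha, by simpa using hb, hab⟩
  let D := G.connectedComponentMk a
  by_cases hc : ∃ c, f c = 2
  · obtain ⟨c, hc⟩ := hc
    have hreach : ∀ i, G.Reachable i c := by
      intro i
      by_cases hi : i = c
      · rw [hi]
      · exact SimpleGraph.Adj.reachable ((hG i c).2 ⟨hi, by simp [hc], by simp [hc]⟩)
    have hD : ∀ i, i ∈ D := fun i =>
      SimpleGraph.ConnectedComponent.sound ((hreach i).trans (hreach a).symm)
    obtain ⟨M, hM, hle⟩ := exists_isAdmissible_of_adj_iff (G := D.toSimpleGraph)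
      (fun i => f i.1)
      (fun i j => by
        rw [D.toSimpleGraph_adj i.2 j.2, hG, Ne, Ne, Subtype.ext_iff])
      ((card_filter_subtype (fun i => f i = 0) _ (fun i _ => hD i) fun _ => Iff.rfl).trans h0)
      ⟨⟨c, hD c⟩, hc⟩
    have h2 : Fintype.card V ≤ Fintype.card D :=
      Fintype.card_le_of_injective (fun i => (⟨i, hD i⟩ : D)) fun i j h => congrArg Subtype.val h
    have := hM.corank_le_mu
    omega
  · push Not at hc
    have hV : Fintype.card V = 6 := by
      rw [← Finset.card_univ, Finset.card_eq_sum_card_fiberwise (f := f) (t := Finset.univ)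
        (by simp), Fin.sum_univ_three, h0, h1]
      simp [hc]
    have hD : ∀ i ∈ D, f i = 0 := by
      intro i hi
      obtain ⟨p⟩ : G.Reachable a i := (SimpleGraph.ConnectedComponent.exact hi).symm
      clear hi hab hb
      induction p with
      | nil => exact ha
      | @cons x y z hxy p ih =>
        apply ih
        rcases fin_three_cases (f y) with h | h | h
        · exact h
        · exact absurd ⟨ha, h⟩ ((hG x y).1 hxy).2.1
        · exact absurd h (hc y)
    have : Nonempty D := ⟨⟨a, rfl⟩⟩
    obtain ⟨M, hM, hle⟩ := exists_isAdmissible_of_complete (G := D.toSimpleGraph)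
      (fun i j hij => (D.toSimpleGraph_adj i.2 j.2).2 ((hG _ _).2
        ⟨fun h => hij (Subtype.ext h), by simp [hD _ j.2], by simp [hD _ i.2]⟩))
    have h2 : 1 < Fintype.card D := by
      refine Fintype.one_lt_card_iff.2 ⟨⟨a, rfl⟩, ⟨b, ?_⟩, fun h => hab (congrArg Subtype.val h)⟩
      refine SimpleGraph.ConnectedComponent.sound (SimpleGraph.Adj.reachable ?_)
      exact (hG b a).2 ⟨hab.symm, by simp [ha], by simp [hb]⟩
    have := hM.corank_le_mu
    omega

/-! ### Edge count of the complement and conclusion -/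

theorem ncard_edgeSet_add_compl {V : Type*} [Fintype V] (G : SimpleGraph V) :
    G.edgeSet.ncard + Gᶜ.edgeSet.ncard = (Fintype.card V).choose 2 := by
  classical
  rw [← Set.ncard_union_eq (SimpleGraph.disjoint_edgeSet.2 disjoint_compl_right) (Set.toFinite _)
    (Set.toFinite _), ← SimpleGraph.edgeSet_sup, sup_compl_eq_top, Set.ncard_eq_toFinset_card',
    ← SimpleGraph.edgeFinset, SimpleGraph.card_edgeFinset_top_eq_card_choose_two]

/-- The conjectured bound for `μ(Gᶜ)` forces `Gᶜ` to have many edges. -/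
theorem choose_le_ncard_edgeSet_compl {V : Type*} [Fintype V] [Nonempty V] (G : SimpleGraph V)
    (h : Fintype.card V ≤ mu G + mu Gᶜ + 2) :
    (Fintype.card V - 1 - mu G).choose 2 ≤ Gᶜ.edgeSet.ncard := by
  classical
  by_cases h0 : mu Gᶜ = 0
  · rw [Nat.choose_eq_zero_of_lt (by omega)]; exact Nat.zero_le _
  obtain ⟨C, _, M, hM, hk⟩ := exists_corank_eq_mu Gᶜ h0
  have hsub := ncard_edgeSet_toSimpleGraph_le C
  rcases hM.choose_corank_le_or C.connected_toSimpleGraph with hle | ⟨h4, f, hf, ht, hff⟩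
  · exact (Nat.choose_le_choose 2 (by omega)).trans (hle.trans hsub)
  have h9 : C.toSimpleGraph.edgeSet.ncard = 9 := by
    rw [ncard_edgeSet_of_adj_iff_ne hf, ht, hff]
  by_cases h10 : 10 ≤ Gᶜ.edgeSet.ncard
  · exact (Nat.choose_le_choose 2 (by omega : _ ≤ 5)).trans h10
  -- With at most 9 edges in Gᶜ, all of them lie in the K₃,₃ component. The map g below sends its
  -- two sides to 0 and 1 and every other vertex to 2.
  have hmem := fun i j => mem_of_adj_of_ncard_le C (i := i) (j := j) (by omega)
  let g : V → Fin 3 := fun i => if hi : i ∈ C then (if f ⟨i, hi⟩ = true then 0 else 1) else 2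
  have hg0 : ∀ i, g i = 0 ↔ ∃ hi : i ∈ C, f ⟨i, hi⟩ = true := by
    intro i
    by_cases hi : i ∈ C
    · by_cases hfi : f ⟨i, hi⟩ = true <;> simp [g, hi, hfi]
    · simp [g, hi]
  have hg1 : ∀ i, g i = 1 ↔ ∃ hi : i ∈ C, f ⟨i, hi⟩ = false := by
    intro i
    by_cases hi : i ∈ C
    · by_cases hfi : f ⟨i, hi⟩ = true <;> simp [g, hi, hfi]
    · simp [g, hi]
  have hadj : ∀ i j, Gᶜ.Adj i j ↔ (g i = 0 ∧ g j = 1) ∨ (g i = 1 ∧ g j = 0) := by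
    intro i j
    rw [hg0, hg1, hg0, hg1]
    constructor
    · intro hij
      have hi := hmem i j hij
      have hj := hmem j i hij.symm
      have := (hf ⟨i, hi⟩ ⟨j, hj⟩).1 ((C.toSimpleGraph_adj hi hj).2 hij)
      cases h1 : f ⟨i, hi⟩ <;> cases h2 : f ⟨j, hj⟩ <;> simp [h1, h2, hi, hj] at this ⊢
    · rintro (⟨⟨hi, h1⟩, hj, h2⟩ | ⟨⟨hi, h1⟩, hj, h2⟩) <;>
        exact (C.toSimpleGraph_adj hi hj).1 ((hf _ _).2 (by simp [h1, h2]))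
  have h5 := card_le_mu_add_five (G := G) g
    (fun i j => by
      rw [← not_or, ← hadj, SimpleGraph.compl_adj]
      by_cases hij : i = j
      · subst hij; simp
      · simp [hij])
    ((card_filter_subtype (s := (· ∈ C)) (fun i => g i = 0) (fun i => f i = true)
      (fun i hi => ((hg0 i).1 hi).1) fun i => by simp [hg0, i.2]).symm.trans ht)
    ((card_filter_subtype (s := (· ∈ C)) (fun i => g i = 1) (fun i => f i = false)
      (fun i hi => ((hg1 i).1 hi).1) fun i => by simp [hg1, i.2]).symm.trans hff)
  have h6 : (Fintype.card V - 1 - mu G).choose 2 ≤ (4 : ℕ).choose 2 :=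
    Nat.choose_le_choose 2 (by omega)
  have h7 : (4 : ℕ).choose 2 = 6 := rfl
  omega

theorem two_mul_cast_choose_two (n : ℕ) : 2 * (n.choose 2 : ℤ) = n * (n - 1) := by
  have h := Nat.cast_choose_two ℚ n
  have : 2 * (n.choose 2 : ℚ) = n * (n - 1) := by rw [h]; ring
  exact_mod_cast this

end ColinDeVerdiere

theorem mainTheorem2
    (graphComplementConjecture :
      ∀ (V : Type u) [Fintype V] [Nonempty V] (G : SimpleGraph V),
        (ColinDeVerdiere.mu G : ℤ) + (ColinDeVerdiere.mu Gᶜ : ℤ) ≥ (Fintype.card V : ℤ) - 2)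
    (V : Type u) [Fintype V] [Nonempty V] (G : SimpleGraph V) :
    (G.edgeSet.ncard : ℤ) ≤
      ((ColinDeVerdiere.mu G : ℤ) + 1) * (Fintype.card V : ℤ)
        - (((ColinDeVerdiere.mu G + 2).choose 2 : ℕ) : ℤ) := by
  have hlt := ColinDeVerdiere.mu_lt_card G
  have hE := ColinDeVerdiere.ncard_edgeSet_add_compl G
  have hle := ColinDeVerdiere.choose_le_ncard_edgeSet_compl G
    (by have := graphComplementConjecture V G; omega)
  -- Substituting n = μ(G) + 1 + t removes the truncated subtraction; what remains is the identity
  -- C(n, 2) - C(t, 2) = (μ + 1)n - C(μ + 2, 2).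
  obtain ⟨t, ht⟩ := Nat.exists_eq_add_of_le hlt
  rw [ht] at hE hle ⊢
  rw [show (ColinDeVerdiere.mu G).succ + t - 1 - ColinDeVerdiere.mu G = t by omega] at hle
  have h1 := ColinDeVerdiere.two_mul_cast_choose_two ((ColinDeVerdiere.mu G).succ + t)
  have h2 := ColinDeVerdiere.two_mul_cast_choose_two (ColinDeVerdiere.mu G + 2)
  have h3 := ColinDeVerdiere.two_mul_cast_choose_two t
  zify at hE hle
  push_cast at h1 h2 h3 hE ⊢
  nlinarith
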